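/- **Setting.** Consider $m+n$ qubits, the last $n$ of which are ancillas. Write $\mathcal P^{q}=\{I,X,Y,Z\}^{q}$ for the $q$-qubit Pauli strings (Pauli operators modulo phase), $\langle P,Q\rangle\in\mathbb Z_2$ for the symplectic product ($0$ if $P,Q$ commute, $1$ otherwise), $Z^x$ ($x\in\mathbb Z_2^n$) for the string acting as $Z$ where $x_j=1$ and as $I$ elsewhere, and $pt(P)\in\mathbb Z_2^{q}$ for the weight pattern of $P$ (bit $i$ is $0$ iff $P$ acts as the identity on qubit $i$), signs being ignored. Let $G$ be a Clifford gate on the $m+n$ qubits, $\mathcal G(\rho)=G\rho G^\dagger$, $\mathcal G^\dagger(A)=G^\dagger AG$, and let $\{\mathcal G_i\}$ be a family of further Clifford gates on these qubits. A *noise model* $\mathcal N$ consists of 1. an initial density matrix $\rho$; 2. for every $\mathcal G_i$, a Pauli channel $\Lambda_i=\sum_P p_i^P\,P(\cdot)P$ applied after the gate; 3. a probability distribution $(p_{a,b}^P)_{a,b\in\mathbb Z_2^n,\,P\in\mathcal P^m}$ defining the mid-circuit measurement (MCM): outcome $k\in\mathbb Z_2^n$ acts as $\mathcal T_k=\mathcal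 U_k\mathcal G$ with $$\mathcal U_k(\sigma)=\sum_{a,b,P}p_{a,b}^P\,(P\otimes|k+b\rangle\langle k+a|)\,\sigma\,(P\otimes|k+a\rangle\langle k+b|);$$ 4. a Pauli channel $\Lambda_M$ applied before the terminating measurement, whose Pauli fidelities $\sum_{P}(-1)^{\langle P,F\rangle}p_M^P$ depend only on $pt(F)$ and are denoted $\lambda_M^{pt(F)}$. All error rates and all Pauli fidelities of these noise channels are strictly positive; the Pauli fidelities of the MCM are $$\lambda_{x,y}^Q=\sum_{a,b,P}(-1)^{a\cdot x+b\cdot y+\langle P,Q\rangle}p_{a,b}^P .$$ Single-qubit unitaries are noiseless. An *experiment* prepares $\rho$, applies a finite sequence of layers of single-qubit unitaries, noisy gates $\Lambda_i\mathcal G_i$ and noisy MCMs, then applies $\Lambda_M$ and measures a finite POVM; it yields a probability distribution on the MCM outcomes and the terminating outcome. Two noise models are *indistinguishable* if every experiment has the same outcome distribution under both. A real function $f$ of noise models is *learnable* on a class of noise models if $f(\mathcal N_1)=f(\mathcal N_2)$ for all indistinguishable $\mathcal N_1,\mathcal N_2$ in the class. The *pattern transfer graph* is the directed multigraph with vertex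 set $\mathbb Z_2^{m+n}$ and, for all $x,y\in\mathbb Z_2^n$ and $Q\in\mathcal P^m$, an edge $e_{x,y}^Q$ from $pt(\mathcal G^\dagger(Q\otimes Z^x))$ to $pt(Q\otimes Z^y)$. As functions of noise models, $v(\mathcal N)=\log\lambda_M^{v}$ for a vertex $v$ and $e_{x,y}^Q(\mathcal N)=\log\lambda_{x,y}^Q$ for an edge. **Theorem 1 (Main result).** Let $v_0,e_{x_1,y_1}^{Q_1},v_1,\ldots,e_{x_l,y_l}^{Q_l},v_l$ be a directed path in the pattern transfer graph, and let $$f=-v_0+\sum_{i=1}^l e_{x_i,y_i}^{Q_i}+v_l .$$ Then $f$ is learnable on the class of noise models whose initial state has a nonzero component of pattern $v_0$, i.e. $\operatorname{Tr}(P\rho)\neq0$ for some $P\in\mathcal P^{m+n}$ with $pt(P)=v_0$. Moreover, $f$ is learned by two experiments: for every $P_0\in\mathcal P^{m+n}$ with $pt(P_0)=v_0$ there are two experiments and, for each, a real function of its outcomes, none of them depending on the noise model, such that for every noise model with $\operatorname{Tr}(P_0\rho)\ne0$ the expectations $s,t$ of these two functions satisfy $s/t>0$ and $f(\mathcal N)=\log(s/t)$.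 -/

import Mathlib

open Matrix
open scoped ComplexOrder

noncomputable section

namespace MCM

/-! ## Qubits, Pauli strings, operators -/

/-- Bit strings, i.e. elements of `ℤ₂^q`. They index the computational basis of the qubits `q`. -/
abbrev Bits (q : Type) := q → ZMod 2

/-- Operators on the Hilbert space of the qubits `q`, as matrices in the computational basis. -/
abbrev Op (q : Type) := Matrix (Bits q) (Bits q) ℂ

/-- The `m + n` qubits of the register: `Sum.inl i` are the `m` unmeasured qubits,
`Sum.inr j` the `n` ancilla qubits that are measured. -/
abbrev Qubits (m n : ℕ) := Fin m ⊕ Fin n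

inductive Pauli
  | I | X | Y | Z
  deriving DecidableEq

instance : Fintype Pauli := ⟨{.I, .X, .Y, .Z}, fun P => by cases P <;> simp⟩

/-- The `2 × 2` matrix of a single-qubit Pauli operator. -/
def Pauli.mat : Pauli → Matrix (ZMod 2) (ZMod 2) ℂ
  | .I => 1
  | .X => Matrix.of fun s t => if s = t then 0 else 1
  | .Y => Matrix.of fun s t => if s = t then 0 else if s = 0 then -Complex.I else Complex.I
  | .Z => Matrix.of fun s t => if s = t then (if s = 0 then 1 else -1) else 0

/-- Pauli strings: the Pauli group of the qubits `q` modulo phases. -/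
abbrev Paulis (q : Type) := q → Pauli

variable {q : Type} [Fintype q] [DecidableEq q]

/-- The tensor product of single-qubit operators, one for every qubit. -/
def tensorOp (A : q → Matrix (ZMod 2) (ZMod 2) ℂ) : Op q :=
  Matrix.of fun s t => ∏ i, A i (s i) (t i)

/-- The operator of a Pauli string. -/
def pauliOp (P : Paulis q) : Op q := tensorOp fun i => (P i).mat

/-- `Z^x`: acts as `Z` where the bit of `x` is `1` and as the identity elsewhere. -/
def zPow (x : Bits q) : Paulis q := fun i => if x i = 0 then .I else .Z

/-- The Pauli weight pattern: bit `i` is `0` exactly if `P` acts as the identity on qubit `i`. -/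
def pt (P : Paulis q) : Bits q := fun i => if P i = .I then 0 else 1

/-- The symplectic inner product: `0` if the two Pauli operators commute, `1` otherwise
(two strings commute iff they anticommute on an even number of qubits). -/
def sympl (P Q : Paulis q) : ZMod 2 :=
  ∑ i, if P i = .I ∨ Q i = .I ∨ P i = Q i then 0 else 1

/-- `(-1)^z` for a bit `z`. -/
def sgn (z : ZMod 2) : ℝ := if z = 0 then 1 else -1

/-- The map `ρ ↦ A ρ A†`. -/
def conj (A ρ : Op q) : Op q := A * ρ * Aᴴ

/-- A Clifford gate: a unitary that normalizes the Pauli group (conjugating a Hermitian operator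
by a unitary gives a Hermitian operator, so only the phases `± 1` can occur). -/
structure Clifford (q : Type) [Fintype q] [DecidableEq q] where
  op : Op q
  unitary : op ∈ Matrix.unitaryGroup (Bits q) ℂ
  conj_pauli : ∀ P : Paulis q, ∃ R : Paulis q,
    op * pauliOp P * opᴴ = pauliOp R ∨ op * pauliOp P * opᴴ = -pauliOp R
  conj_pauli' : ∀ P : Paulis q, ∃ R : Paulis q,
    opᴴ * pauliOp P * op = pauliOp R ∨ opᴴ * pauliOp P * op = -pauliOp R

/-- The Pauli string of `𝒢†(P) = G† P G` (which is that string up to a sign). -/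
def Clifford.pull (G : Clifford q) (P : Paulis q) : Paulis q :=
  (G.conj_pauli' P).choose

/-! ## Noise -/

/-- The Pauli fidelity `λ^Q = ∑_P (-1)^⟨P,Q⟩ p^P` of the Pauli channel with error rates `p`. -/
def pauliFidelity (p : Paulis q → ℝ) (Q : Paulis q) : ℝ := ∑ P, sgn (sympl P Q) * p P

/-- A Pauli noise channel: its error rates form a probability distribution which is not on the
boundary of the simplex, and its Pauli fidelities are strictly positive. -/
structure PauliNoise (q : Type) [Fintype q] [DecidableEq q] where
  rate : Paulis q → ℝ
  rate_pos : ∀ P, 0 < rate P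
  rate_sum : ∑ P, rate P = 1
  fidelity_pos : ∀ Q, 0 < pauliFidelity rate Q

/-- The channel `Λ = ∑_P p^P 𝒫`. -/
def PauliNoise.apply (L : PauliNoise q) (ρ : Op q) : Op q :=
  ∑ P, (L.rate P : ℂ) • conj (pauliOp P) ρ

/-- A symmetric Pauli noise channel: its Pauli fidelities depend only on the weight pattern;
`lam v` is their common value on the pattern `v`. -/
structure SymmPauliNoise (q : Type) [Fintype q] [DecidableEq q] extends PauliNoise q where
  lam : Bits q → ℝ
  fidelity_eq : ∀ Q, pauliFidelity rate Q = lam (pt Q)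

variable {m n : ℕ}

/-- The Pauli fidelity `λ_{x,y}^Q = ∑_{a,b,P} (-1)^{a·x + b·y + ⟨P,Q⟩} p_{a,b}^P` of the uniform
stochastic instrument with error rates `p`. -/
def instrFidelity (p : Bits (Fin n) → Bits (Fin n) → Paulis (Fin m) → ℝ)
    (x y : Bits (Fin n)) (Q : Paulis (Fin m)) : ℝ :=
  ∑ a, ∑ b, ∑ P, sgn (a ⬝ᵥ x + b ⬝ᵥ y + sympl P Q) * p a b P

/-- The parameters of a uniform stochastic instrument: the error rates `p_{a,b}^P` form a
probability distribution which is not on the boundary of the simplex, and the Pauli fidelities are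
strictly positive. -/
structure InstrNoise (m n : ℕ) where
  rate : Bits (Fin n) → Bits (Fin n) → Paulis (Fin m) → ℝ
  rate_pos : ∀ a b P, 0 < rate a b P
  rate_sum : ∑ a, ∑ b, ∑ P, rate a b P = 1
  fidelity_pos : ∀ x y Q, 0 < instrFidelity rate x y Q

/-- The operator `P ⊗ |s⟩⟨t|`, with `P` on the unmeasured qubits and `|s⟩⟨t|` on the ancillas. -/
def pauliKetBra (P : Paulis (Fin m)) (s t : Bits (Fin n)) : Op (Qubits m n) :=
  tensorOp (Sum.elim (fun i => (P i).mat) (fun j => Matrix.single (s j) (t j) 1))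

/-- The uniform stochastic instrument at outcome `k`:
`𝒰_k(ρ) = ∑_{a,b,P} p_{a,b}^P (P ⊗ |k+b⟩⟨k+a|) ρ (P ⊗ |k+a⟩⟨k+b|)`. -/
def InstrNoise.instr (U : InstrNoise m n) (k : Bits (Fin n)) (ρ : Op (Qubits m n)) :
    Op (Qubits m n) :=
  ∑ a, ∑ b, ∑ P, (U.rate a b P : ℂ) • conj (pauliKetBra P (k + b) (k + a)) ρ

/-- The ideal operations of the device: the Clifford gate `G` of the mid-circuit measurement, and
the further multi-qubit Clifford gates `𝒢_i` that can be applied. -/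
structure Setup (ι : Type*) (m n : ℕ) where
  mcmGate : Clifford (Qubits m n)
  gate : ι → Clifford (Qubits m n)

/-- A noise model: the initial state, the noise channel of each multi-qubit Clifford gate, the
uniform stochastic instrument of the mid-circuit measurement, and the noise channel of the
terminating measurement. Single-qubit gates are noiseless. -/
structure NoiseModel (ι : Type*) (m n : ℕ) where
  state : Op (Qubits m n)
  state_psd : state.PosSemidef
  state_trace : state.trace = 1
  gateNoise : ι → PauliNoise (Qubits m n)
  mcmNoise : InstrNoise m n
  measNoise : SymmPauliNoise (Qubits m n)

/-! ## Experiments and learnability -/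

/-- A layer of single-qubit gates. -/
abbrev Layer (q : Type) := q → Matrix.unitaryGroup (ZMod 2) ℂ

/-- Circuits with `d` mid-circuit measurements, listed in the order of time. -/
inductive Circuit (ι : Type*) (m n : ℕ) : ℕ → Type _
  | done : Circuit ι m n 0
  | layer {d : ℕ} (U : Layer (Qubits m n)) (c : Circuit ι m n d) : Circuit ι m n d
  | gate {d : ℕ} (i : ι) (c : Circuit ι m n d) : Circuit ι m n d
  | mcm {d : ℕ} (c : Circuit ι m n d) : Circuit ι m n (d + 1)

/-- An experiment: prepare the initial state, apply a circuit, measure a (finite) POVM. -/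
structure Experiment (ι : Type*) (m n : ℕ) where
  numMCM : ℕ
  circuit : Circuit ι m n numMCM
  numOut : ℕ
  povm : Fin numOut → Op (Qubits m n)
  povm_psd : ∀ j, (povm j).PosSemidef
  povm_sum : ∑ j, povm j = 1

variable {ι : Type*}

/-- The unnormalized state after a circuit has been applied to `ρ` and the mid-circuit outcomes `k`
have been observed. The mid-circuit measurement with outcome `k` acts as `𝒯_k = 𝒰_k 𝒢`. -/
def NoiseModel.run (S : Setup ι m n) (N : NoiseModel ι m n) :
    {d : ℕ} → Circuit ι m n d → (Fin d → Bits (Fin n)) → Op (Qubits m n) → Op (Qubits m n)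
  | _, .done, _, ρ => ρ
  | _, .layer U c, k, ρ => N.run S c k (conj (tensorOp fun i => (U i).1) ρ)
  | _, .gate i c, k, ρ => N.run S c k ((N.gateNoise i).apply (conj (S.gate i).op ρ))
  | _, .mcm c, k, ρ => N.run S c (Fin.tail k) (N.mcmNoise.instr (k 0) (conj S.mcmGate.op ρ))

/-- The probability of the mid-circuit outcomes `k` and the terminating outcome `j`. -/
def Experiment.prob (S : Setup ι m n) (N : NoiseModel ι m n) (E : Experiment ι m n)
    (k : Fin E.numMCM → Bits (Fin n)) (j : Fin E.numOut) : ℝ :=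
  ((E.povm j * N.measNoise.apply (N.run S E.circuit k N.state)).trace).re

/-- The expectation of a function `w` of the outcomes. -/
def Experiment.mean (S : Setup ι m n) (N : NoiseModel ι m n) (E : Experiment ι m n)
    (w : (Fin E.numMCM → Bits (Fin n)) → Fin E.numOut → ℝ) : ℝ :=
  ∑ k, ∑ j, w k j * E.prob S N k j

/-- Every experiment has the same outcome distribution under both noise models. -/
def Indistinguishable (S : Setup ι m n) (N₁ N₂ : NoiseModel ι m n) : Prop :=
  ∀ (E : Experiment ι m n) (k : Fin E.numMCM → Bits (Fin n)) (j : Fin E.numOut),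
    E.prob S N₁ k j = E.prob S N₂ k j

/-- `f` is learnable on the class `𝒩` of noise models. -/
def LearnableOn (S : Setup ι m n) (𝒩 : Set (NoiseModel ι m n)) (f : NoiseModel ι m n → ℝ) : Prop :=
  ∀ N₁ ∈ 𝒩, ∀ N₂ ∈ 𝒩, Indistinguishable S N₁ N₂ → f N₁ = f N₂

/-- The initial state has a nonzero Pauli component of weight pattern `v`. -/
def NoiseModel.HasComponent (N : NoiseModel ι m n) (v : Bits (Qubits m n)) : Prop :=
  ∃ P : Paulis (Qubits m n), pt P = v ∧ (pauliOp P * N.state).trace ≠ 0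

/-! ## The pattern transfer graph -/

/-- The (label of the) edge `e_{x,y}^Q`. Edges with distinct labels are distinct. -/
structure Edge (m n : ℕ) where
  Q : Paulis (Fin m)
  x : Bits (Fin n)
  y : Bits (Fin n)

/-- The start vertex `pt(𝒢†(Q ⊗ Z^x))`. -/
def Edge.src (G : Clifford (Qubits m n)) (e : Edge m n) : Bits (Qubits m n) :=
  pt (G.pull (Sum.elim e.Q (zPow e.x)))

/-- The end vertex `pt(Q ⊗ Z^y)`. -/
def Edge.tgt (e : Edge m n) : Bits (Qubits m n) :=
  pt (Sum.elim e.Q (zPow e.y) : Paulis (Qubits m n))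

/-- `IsPath G u es v`: the edges `es` form a directed path from `u` to `v`. -/
inductive IsPath (G : Clifford (Qubits m n)) :
    Bits (Qubits m n) → List (Edge m n) → Bits (Qubits m n) → Prop
  | nil (v : Bits (Qubits m n)) : IsPath G v [] v
  | cons {w : Bits (Qubits m n)} (e : Edge m n) {es : List (Edge m n)}
      (h : IsPath G e.tgt es w) : IsPath G (e.src G) (e :: es) w

/-- A vertex as a function of noise models: `v(𝒩) = log λ_M^v`. -/
def vertexFn (v : Bits (Qubits m n)) (N : NoiseModel ι m n) : ℝ := Real.log (N.measNoise.lam v)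

/-- An edge as a function of noise models: `e_{x,y}^Q(𝒩) = log λ_{x,y}^Q`. -/
def edgeFn (e : Edge m n) (N : NoiseModel ι m n) : ℝ :=
  Real.log (instrFidelity N.mcmNoise.rate e.x e.y e.Q)

/-- The function `-v₀ + ∑ᵢ eᵢ + vₗ` of noise models. -/
def pathFn (v₀ : Bits (Qubits m n)) (es : List (Edge m n)) (vₗ : Bits (Qubits m n)) :
    NoiseModel ι m n → ℝ :=
  -vertexFn v₀ + (es.map edgeFn).sum + vertexFn vₗ

end MCM

end

/-!
The proof works in the Heisenberg picture. A Pauli channel multiplies a Pauli observable by its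
fidelity (`PauliNoise.trace_apply`). The same is true of the uniform stochastic instrument when
its outcomes `k` are summed with the sign `(-1)^(k·(x+y))`: this sum sends the observable `Q ⊗ Z^y` to
`λ_{x,y}^Q (Q ⊗ Z^x)` (`InstrNoise.sum_trace_instr`), and the ideal gate `G` pulls `Q ⊗ Z^x` back
to a Pauli string of the pattern at which the edge `e_{x,y}^Q` starts. Two Pauli strings of the
same pattern are conjugate under single-qubit unitaries (`exists_layer_conj`), which are noiseless.

Hence, along a path, layers of single-qubit unitaries can be placed between successive
mid-circuit measurements so that the signed sum over all outcomes of the final Pauli observable is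
the product of the fidelities of the edges times the component `Tr(P₀ρ)` of the initial state
(`exists_circuit_of_isPath`). Adding the terminating measurement gives `s = λ_M^{vₗ} ∏ λ · Tr(P₀ρ)`.
Measuring `P₀` right after the preparation gives `t = λ_M^{v₀} Tr(P₀ρ)`. The unknown state cancels
in `s / t`, whose logarithm is the path function. Learnability follows, because `t`, and with it
the condition `Tr(P₀ρ) ≠ 0`, is the same for indistinguishable noise models.
-/

namespace MCM

/-! ### Signs and single-qubit Pauli matrices -/

lemma forall_zmod_two {p : ZMod 2 → Prop} : (∀ z, p z) ↔ p 0 ∧ p 1 :=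
  Fin.forall_fin_two

lemma sum_zmod_two {M : Type*} [AddCommMonoid M] (f : ZMod 2 → M) : ∑ z, f z = f 0 + f 1 :=
  Fin.sum_univ_two f

lemma sgn_zero : sgn 0 = 1 := by simp [sgn]

lemma sgn_add (a b : ZMod 2) : sgn (a + b) = sgn a * sgn b := by
  have h2 : (1 : ZMod 2) + 1 = 0 := by decide
  have key : ∀ a : ZMod 2, a = 0 ∨ a = 1 := by decide
  rcases key a with rfl | rfl <;> rcases key b with rfl | rfl <;> simp [sgn, h2]

lemma sgn_sum {α : Type*} (s : Finset α) (f : α → ZMod 2) :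
    sgn (∑ i ∈ s, f i) = ∏ i ∈ s, sgn (f i) := by
  classical
  induction s using Finset.induction_on with
  | empty => simp [sgn_zero]
  | insert a s ha ih => rw [Finset.sum_insert ha, Finset.prod_insert ha, sgn_add, ih]

lemma Pauli.mat_conjTranspose (P : Pauli) : P.matᴴ = P.mat := by
  ext s t
  revert s t
  cases P <;> simp [forall_zmod_two, Pauli.mat]

lemma Pauli.mat_mul_self (P : Pauli) : P.mat * P.mat = 1 := by
  ext s t
  rw [Matrix.mul_apply, sum_zmod_two]
  revert s t
  cases P <;> simp [forall_zmod_two, Pauli.mat]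

lemma Pauli.mat_mul_mat_comm (P R : Pauli) :
    P.mat * R.mat =
      (sgn (if P = .I ∨ R = .I ∨ P = R then 0 else 1) : ℂ) • (R.mat * P.mat) := by
  ext s t
  rw [Matrix.smul_apply, Matrix.mul_apply, Matrix.mul_apply, sum_zmod_two, sum_zmod_two]
  revert s t
  cases P <;> cases R <;> simp [forall_zmod_two, Pauli.mat, sgn]

lemma Pauli.mat_conj (P R : Pauli) :
    P.mat * R.mat * P.mat =
      (sgn (if P = .I ∨ R = .I ∨ P = R then 0 else 1) : ℂ) • R.mat := by
  rw [Pauli.mat_mul_mat_comm, smul_mul_assoc, mul_assoc, Pauli.mat_mul_self, mul_one]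

lemma zPow_mat {α : Type} (x : Bits α) (i : α) :
    (zPow x i).mat = ∑ b : ZMod 2, (sgn (b * x i) : ℂ) • Matrix.single b b (1 : ℂ) := by
  have key : ∀ a : ZMod 2, a = 0 ∨ a = 1 := by decide
  ext s t
  rw [Matrix.sum_apply, sum_zmod_two]
  revert s t
  rcases key (x i) with h | h <;>
    simp [forall_zmod_two, Pauli.mat, zPow, sgn, h, Matrix.single_apply]

/-- Two distinct Pauli matrices `P`, `R` other than the identity anticommute, so `(P + R) / √2` is
a unitary that swaps them. -/
lemma Pauli.exists_unitary_conj (P R : Pauli) (h : P = .I ↔ R = .I) :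
    ∃ U : Matrix.unitaryGroup (ZMod 2) ℂ, U.1ᴴ * R.mat * U.1 = P.mat := by
  by_cases hPR : P = R
  · exact ⟨1, by simp [hPR]⟩
  have hP : P ≠ .I := fun h' => hPR (h'.trans (h.1 h').symm)
  have hR : R ≠ .I := fun h' => hPR ((h.2 h').trans h'.symm)
  have anti : P.mat * R.mat = -(R.mat * P.mat) := by
    rw [Pauli.mat_mul_mat_comm]
    simp [hP, hR, hPR, sgn]
  have hc : ((√2 : ℝ) : ℂ)⁻¹ * ((√2 : ℝ) : ℂ)⁻¹ = 1 / 2 := by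
    rw [← mul_inv, ← Complex.ofReal_mul, Real.mul_self_sqrt (by norm_num)]
    norm_num
  set c : ℂ := ((√2 : ℝ) : ℂ)⁻¹ with hcdef
  have hstar : star c = c := by simp [hcdef]
  have hUH : (c • (P.mat + R.mat))ᴴ = c • (P.mat + R.mat) := by
    rw [Matrix.conjTranspose_smul, hstar, Matrix.conjTranspose_add, Pauli.mat_conjTranspose,
      Pauli.mat_conjTranspose]
  have hUR : (P.mat + R.mat) * (P.mat + R.mat) = (2 : ℂ) • 1 := by
    rw [add_mul, mul_add, mul_add, Pauli.mat_mul_self, Pauli.mat_mul_self, anti, two_smul]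
    abel
  have hswap : (P.mat + R.mat) * R.mat = P.mat * (P.mat + R.mat) := by
    rw [add_mul, mul_add, Pauli.mat_mul_self, Pauli.mat_mul_self, add_comm]
  refine ⟨⟨c • (P.mat + R.mat), ?_⟩, ?_⟩
  · rw [Matrix.mem_unitaryGroup_iff, Matrix.star_eq_conjTranspose, hUH, smul_mul_smul_comm, hc,
      hUR, smul_smul]
    norm_num
  · change (c • (P.mat + R.mat))ᴴ * R.mat * (c • (P.mat + R.mat)) = P.mat
    rw [hUH, smul_mul_assoc, smul_mul_smul_comm, hc, hswap, mul_assoc, hUR, mul_smul_comm,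
      mul_one, smul_smul]
    norm_num

/-! ### Tensor products and Pauli strings -/

section Tensor

variable {q : Type} [Fintype q]

lemma tensorOp_conjTranspose (A : q → Matrix (ZMod 2) (ZMod 2) ℂ) :
    (tensorOp A)ᴴ = tensorOp fun i => (A i)ᴴ := by
  ext s t
  simp [tensorOp, Matrix.conjTranspose_apply]

lemma tensorOp_one : tensorOp (fun _ : q => (1 : Matrix (ZMod 2) (ZMod 2) ℂ)) = 1 := by
  ext s t
  by_cases h : s = t
  · subst h
    simp [tensorOp]
  · obtain ⟨i, hi⟩ := Function.ne_iff.1 h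
    rw [Matrix.one_apply_ne h]
    exact Finset.prod_eq_zero (Finset.mem_univ i) (Matrix.one_apply_ne hi)

lemma tensorOp_smul (c : q → ℂ) (A : q → Matrix (ZMod 2) (ZMod 2) ℂ) :
    (tensorOp fun i => c i • A i) = (∏ i, c i) • tensorOp A := by
  ext s t
  simp [tensorOp, Finset.prod_mul_distrib]

lemma pauliOp_conjTranspose (P : Paulis q) : (pauliOp P)ᴴ = pauliOp P := by
  simp only [pauliOp, tensorOp_conjTranspose, Pauli.mat_conjTranspose]

variable [DecidableEq q]

lemma tensorOp_mul (A B : q → Matrix (ZMod 2) (ZMod 2) ℂ) :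
    tensorOp A * tensorOp B = tensorOp fun i => A i * B i := by
  ext s t
  simp only [tensorOp, Matrix.mul_apply, Matrix.of_apply, ← Finset.prod_mul_distrib]
  rw [Finset.prod_univ_sum, Fintype.piFinset_univ]

/-- The tensor product is additive in the factors at `Sum.inr`. -/
lemma tensorOp_sumElim_sum {p r : Type} [Fintype p] [Fintype r] [DecidableEq r]
    {β : Type*} [Fintype β] (A : p → Matrix (ZMod 2) (ZMod 2) ℂ)
    (B : r → β → Matrix (ZMod 2) (ZMod 2) ℂ) :
    tensorOp (Sum.elim A fun j => ∑ b, B j b) =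
      ∑ t : r → β, tensorOp (Sum.elim A fun j => B j (t j)) := by
  ext s s'
  simp only [tensorOp, Matrix.sum_apply, Matrix.of_apply, Fintype.prod_sum_type, Sum.elim_inl,
    Sum.elim_inr, ← Finset.mul_sum]
  rw [Finset.prod_univ_sum, Fintype.piFinset_univ]

lemma pauliOp_mul_self (P : Paulis q) : pauliOp P * pauliOp P = 1 := by
  simp only [pauliOp, tensorOp_mul, Pauli.mat_mul_self, tensorOp_one]

lemma pauliOp_conj (P R : Paulis q) :
    pauliOp P * pauliOp R * pauliOp P = (sgn (sympl P R) : ℂ) • pauliOp R := by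
  simp only [pauliOp, tensorOp_mul, Pauli.mat_conj, tensorOp_smul, sympl, sgn_sum,
    Complex.ofReal_prod]

/-- Passing from the Schrödinger to the Heisenberg picture. -/
lemma trace_mul_conj (A K ρ : Op q) : (A * conj K ρ).trace = (Kᴴ * A * K * ρ).trace := by
  rw [conj, ← mul_assoc, ← mul_assoc, Matrix.trace_mul_comm]
  simp only [mul_assoc]

lemma exists_layer_conj (P R : Paulis q) (h : pt P = pt R) :
    ∃ U : Layer q, ∀ ρ : Op q,
      (pauliOp R * conj (tensorOp fun i => (U i).1) ρ).trace = (pauliOp P * ρ).trace := by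
  have hI : ∀ i, P i = .I ↔ R i = .I := fun i => by
    have := congrFun h i
    by_cases h1 : P i = .I <;> by_cases h2 : R i = .I <;> simp_all [pt]
  choose U hU using fun i => Pauli.exists_unitary_conj (P i) (R i) (hI i)
  refine ⟨U, fun ρ => ?_⟩
  rw [trace_mul_conj, tensorOp_conjTranspose]
  simp only [pauliOp, tensorOp_mul, hU]

lemma Clifford.exists_sign_pull (G : Clifford q) (R : Paulis q) :
    ∃ ε : ℝ, ε * ε = 1 ∧ ∀ ρ : Op q,
      (pauliOp R * conj G.op ρ).trace = (ε : ℂ) * (pauliOp (G.pull R) * ρ).trace := by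
  rcases (G.conj_pauli' R).choose_spec with h | h
  · refine ⟨1, by norm_num, fun ρ => ?_⟩
    rw [trace_mul_conj, h, Clifford.pull, Complex.ofReal_one, one_mul]
  · refine ⟨-1, by norm_num, fun ρ => ?_⟩
    rw [trace_mul_conj, h, Clifford.pull]
    simp

/-! ### Noise in the Heisenberg picture -/

lemma PauliNoise.trace_apply (L : PauliNoise q) (Q : Paulis q) (ρ : Op q) :
    (pauliOp Q * L.apply ρ).trace = (pauliFidelity L.rate Q : ℂ) * (pauliOp Q * ρ).trace := by
  simp only [PauliNoise.apply, Finset.mul_sum, mul_smul_comm, Matrix.trace_sum,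
    Matrix.trace_smul, trace_mul_conj, pauliOp_conjTranspose, pauliOp_conj, smul_mul_assoc,
    pauliFidelity, Complex.ofReal_sum, Complex.ofReal_mul, Finset.sum_mul, smul_eq_mul]
  exact Finset.sum_congr rfl fun P _ => by ring

lemma SymmPauliNoise.trace_apply (L : SymmPauliNoise q) (Q : Paulis q) (ρ : Op q) :
    (pauliOp Q * L.toPauliNoise.apply ρ).trace = (L.lam (pt Q) : ℂ) * (pauliOp Q * ρ).trace := by
  rw [PauliNoise.trace_apply, L.fidelity_eq]

lemma SymmPauliNoise.lam_pt_pos (L : SymmPauliNoise q) (Q : Paulis q) : 0 < L.lam (pt Q) :=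
  L.fidelity_eq Q ▸ L.fidelity_pos Q

end Tensor

variable {m n : ℕ}

/-- `Q ⊗ Z^y` pulled back through one Kraus operator of the instrument. -/
lemma pauliKetBra_conj (P Q : Paulis (Fin m)) (y s t : Bits (Fin n)) :
    (pauliKetBra P s t)ᴴ * pauliOp (Sum.elim Q (zPow y)) * pauliKetBra P s t =
      ((sgn (sympl P Q) * sgn (s ⬝ᵥ y) : ℝ) : ℂ) • pauliKetBra Q t t := by
  have hz : ∀ j, (Matrix.single (s j) (t j) (1 : ℂ))ᴴ * (zPow y j).mat *
      Matrix.single (s j) (t j) 1 = (sgn (s j * y j) : ℂ) • Matrix.single (t j) (t j) 1 := by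
    intro j
    rw [zPow_mat, Matrix.conjTranspose_single, star_one, Finset.mul_sum, Finset.sum_mul,
      Finset.sum_eq_single (s j)]
    · simp
    · intro b _ hb
      simp [Ne.symm hb]
    · simp
  have hfac : (fun i => (Sum.elim (fun i => (P i).mat)
        (fun j => Matrix.single (s j) (t j) (1 : ℂ)) i)ᴴ *
          ((Sum.elim Q (zPow y) : Paulis (Fin m ⊕ Fin n)) i).mat *
        Sum.elim (fun i => (P i).mat) (fun j => Matrix.single (s j) (t j) (1 : ℂ)) i) =
      fun i => (Sum.elim
          (fun i => (sgn (if P i = .I ∨ Q i = .I ∨ P i = Q i then 0 else 1) : ℂ))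
          (fun j => (sgn (s j * y j) : ℂ)) i) •
        Sum.elim (fun i => (Q i).mat) (fun j => Matrix.single (t j) (t j) (1 : ℂ)) i := by
    funext i
    rcases i with i | j
    · simp only [Sum.elim_inl, Pauli.mat_conjTranspose, Pauli.mat_conj]
    · exact hz j
  rw [pauliKetBra, pauliKetBra, tensorOp_conjTranspose, pauliOp, tensorOp_mul, tensorOp_mul, hfac,
    tensorOp_smul, Fintype.prod_sum_type]
  simp only [Sum.elim_inl, Sum.elim_inr, sympl, dotProduct, sgn_sum, Complex.ofReal_mul,
    Complex.ofReal_prod]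

lemma pauliOp_eq_sum_pauliKetBra (Q : Paulis (Fin m)) (x : Bits (Fin n)) :
    pauliOp (Sum.elim Q (zPow x)) =
      ∑ t : Bits (Fin n), (sgn (t ⬝ᵥ x) : ℂ) • pauliKetBra Q t t := by
  have h : (fun i => ((Sum.elim Q (zPow x) : Paulis (Fin m ⊕ Fin n)) i).mat) =
      Sum.elim (fun i => (Q i).mat)
        fun j => ∑ b : ZMod 2, (sgn (b * x j) : ℂ) • Matrix.single b b (1 : ℂ) := by
    funext i
    rcases i with i | j
    · rfl
    · exact zPow_mat x j
  rw [pauliOp, h, tensorOp_sumElim_sum]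
  refine Finset.sum_congr rfl fun t _ => ?_
  have h' : (Sum.elim (fun i => (Q i).mat)
      fun j => (sgn (t j * x j) : ℂ) • Matrix.single (t j) (t j) (1 : ℂ)) =
      fun i => (Sum.elim (fun _ => 1) (fun j => (sgn (t j * x j) : ℂ)) i) •
        Sum.elim (fun i => (Q i).mat) (fun j => Matrix.single (t j) (t j) (1 : ℂ)) i := by
    funext i
    rcases i with i | j <;> simp
  rw [h', tensorOp_smul, Fintype.prod_sum_type, pauliKetBra]
  simp [dotProduct, sgn_sum]

/-- Weighting the outcome `k` of the instrument by `(-1)^(k·(x+y))` turns the observable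
`Q ⊗ Z^y` into `λ_{x,y}^Q (Q ⊗ Z^x)`. -/
lemma InstrNoise.sum_trace_instr (U : InstrNoise m n) (Q : Paulis (Fin m)) (x y : Bits (Fin n))
    (ρ : Op (Qubits m n)) :
    ∑ k, (sgn (k ⬝ᵥ (x + y)) : ℂ) * (pauliOp (Sum.elim Q (zPow y)) * U.instr k ρ).trace =
      (instrFidelity U.rate x y Q : ℂ) * (pauliOp (Sum.elim Q (zPow x)) * ρ).trace := by
  -- For fixed `a` the substitution `t = k + a` produces the spectral decomposition of `Q ⊗ Z^x`.
  have key : ∀ a b P, ∑ k, (sgn (k ⬝ᵥ (x + y)) : ℂ) *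
      (pauliOp (Sum.elim Q (zPow y)) * conj (pauliKetBra P (k + b) (k + a)) ρ).trace =
      (sgn (a ⬝ᵥ x + b ⬝ᵥ y + sympl P Q) : ℂ) *
        (pauliOp (Sum.elim Q (zPow x)) * ρ).trace := by
    intro a b P
    rw [pauliOp_eq_sum_pauliKetBra Q x, Finset.sum_mul, Matrix.trace_sum, Finset.mul_sum]
    refine Fintype.sum_equiv (Equiv.addRight a) _ _ fun k => ?_
    simp only [trace_mul_conj, pauliKetBra_conj, smul_mul_assoc, Matrix.trace_smul, smul_eq_mul,
      Equiv.coe_addRight, ← mul_assoc, ← Complex.ofReal_mul, ← sgn_add]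
    congr 3
    have h2 : ∀ z : ZMod 2, z + z = 0 := by decide
    simp only [add_dotProduct, dotProduct_add]
    linear_combination h2 (k ⬝ᵥ y) - h2 (a ⬝ᵥ x)
  have hinstr : ∀ k, (pauliOp (Sum.elim Q (zPow y)) * U.instr k ρ).trace =
      ∑ a, ∑ b, ∑ P, (U.rate a b P : ℂ) *
        (pauliOp (Sum.elim Q (zPow y)) * conj (pauliKetBra P (k + b) (k + a)) ρ).trace := by
    intro k
    simp only [InstrNoise.instr, Finset.mul_sum, mul_smul_comm, Matrix.trace_sum,
      Matrix.trace_smul, smul_eq_mul]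
  simp only [hinstr, Finset.mul_sum, instrFidelity, Complex.ofReal_sum, Finset.sum_mul]
  rw [Finset.sum_comm]
  refine Finset.sum_congr rfl fun a _ => ?_
  rw [Finset.sum_comm]
  refine Finset.sum_congr rfl fun b _ => ?_
  rw [Finset.sum_comm]
  refine Finset.sum_congr rfl fun P _ => ?_
  rw [Complex.ofReal_mul, mul_right_comm, ← key a b P, Finset.sum_mul]
  exact Finset.sum_congr rfl fun k _ => by ring

/-! ### The circuit of a path -/

variable {ι : Type*}

/-- The product of the instrument fidelities of a list of edges. -/
noncomputable def edgeProd (es : List (Edge m n)) (N : NoiseModel ι m n) : ℝ :=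
  (es.map fun e => instrFidelity N.mcmNoise.rate e.x e.y e.Q).prod

lemma edgeProd_pos (es : List (Edge m n)) (N : NoiseModel ι m n) : 0 < edgeProd es N := by
  refine List.prod_pos fun a ha => ?_
  obtain ⟨e, -, rfl⟩ := List.mem_map.1 ha
  exact N.mcmNoise.fidelity_pos _ _ _

lemma log_edgeProd (es : List (Edge m n)) (N : NoiseModel ι m n) :
    Real.log (edgeProd es N) = (es.map edgeFn).sum N := by
  induction es with
  | nil => simp [edgeProd]
  | cons e es ih =>
    have h : edgeProd (e :: es) N =
        instrFidelity N.mcmNoise.rate e.x e.y e.Q * edgeProd es N := by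
      simp [edgeProd]
    rw [h, Real.log_mul (N.mcmNoise.fidelity_pos _ _ _).ne' (edgeProd_pos es N).ne', ih]
    simp [edgeFn]

/-- In the Heisenberg picture the circuit of a path, its outcomes weighted by signs, carries a Pauli
observable at the end of the path to `P₀` at the start. Circuit, weights and observable do not depend
on the noise model. -/
lemma exists_circuit_of_isPath (S : Setup ι m n) {u v : Bits (Qubits m n)}
    {es : List (Edge m n)} (h : IsPath S.mcmGate u es v) :
    ∀ P₀ : Paulis (Qubits m n), pt P₀ = u →
      ∃ (d : ℕ) (c : Circuit ι m n d) (w : (Fin d → Bits (Fin n)) → ℝ) (P : Paulis (Qubits m n)),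
        pt P = v ∧ ∀ (N : NoiseModel ι m n) (ρ : Op (Qubits m n)),
          ∑ k, (w k : ℂ) * (pauliOp P * N.run S c k ρ).trace =
            (edgeProd es N : ℂ) * (pauliOp P₀ * ρ).trace := by
  induction h with
  | nil v =>
    intro P₀ hP₀
    refine ⟨0, .done, fun _ => 1, P₀, hP₀, fun N ρ => ?_⟩
    simp [NoiseModel.run, edgeProd]
  | @cons v e es _ ih =>
    intro P₀ hP₀
    obtain ⟨d, c, w, P, hP, hc⟩ := ih (Sum.elim e.Q (zPow e.y)) rfl
    obtain ⟨U, hU⟩ := exists_layer_conj P₀ _ hP₀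
    obtain ⟨ε, hε, hG⟩ := S.mcmGate.exists_sign_pull (Sum.elim e.Q (zPow e.x))
    -- The factor `ε` cancels the sign that `G` produces when it pulls the observable back.
    refine ⟨d + 1, .layer U (.mcm c),
      fun k => ε * sgn (k 0 ⬝ᵥ (e.x + e.y)) * w (Fin.tail k), P, hP, fun N ρ => ?_⟩
    have hε' : (ε : ℂ) * ε = 1 := by exact_mod_cast hε
    have hprod : edgeProd (e :: es) N =
        instrFidelity N.mcmNoise.rate e.x e.y e.Q * edgeProd es N := by
      simp [edgeProd]
    rw [← Equiv.sum_comp (Fin.consEquiv fun _ => Bits (Fin n)), Fintype.sum_prod_type]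
    have h0 : ∀ p, Fin.consEquiv (fun _ : Fin (d + 1) => Bits (Fin n)) p 0 = p.1 := fun _ => rfl
    have ht : ∀ p, Fin.tail (Fin.consEquiv (fun _ : Fin (d + 1) => Bits (Fin n)) p) = p.2 :=
      fun _ => rfl
    simp only [NoiseModel.run, h0, ht, Complex.ofReal_mul]
    simp only [mul_assoc, ← Finset.mul_sum, hc]
    simp only [mul_left_comm _ (edgeProd es N : ℂ), ← Finset.mul_sum]
    rw [InstrNoise.sum_trace_instr, hG, hU, hprod, Complex.ofReal_mul]
    linear_combination (edgeProd es N : ℂ) * (instrFidelity N.mcmNoise.rate e.x e.y e.Q : ℂ) *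
      (pauliOp P₀ * ρ).trace * hε'

/-! ### Measuring a Pauli observable -/

/-- The projector `(1 ± P) / 2` onto an eigenspace of a Pauli operator; the outcome `0` belongs to
the eigenvalue `1`, the outcome `1` to `-1`. -/
noncomputable def pauliProj {q : Type} [Fintype q] [DecidableEq q] (P : Paulis q) (j : Fin 2) :
    Op q :=
  (1 / 2 : ℂ) • (1 + ((-1) ^ (j : ℕ) : ℂ) • pauliOp P)

lemma pauliProj_posSemidef {q : Type} [Fintype q] [DecidableEq q] (P : Paulis q) (j : Fin 2) :
    (pauliProj P j).PosSemidef := by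
  have hs : ((-1) ^ (j : ℕ) : ℂ) * (-1) ^ (j : ℕ) = 1 := by
    rw [← mul_pow]; simp
  have hH : (pauliProj P j)ᴴ = pauliProj P j := by
    simp [pauliProj, Matrix.conjTranspose_smul, pauliOp_conjTranspose]
  have hsq : (pauliProj P j)ᴴ * pauliProj P j = pauliProj P j := by
    rw [hH, pauliProj, smul_mul_smul_comm, add_mul, mul_add, mul_add, smul_mul_smul_comm,
      pauliOp_mul_self, hs, one_mul, one_mul, mul_one]
    module
  exact hsq ▸ Matrix.posSemidef_conjTranspose_mul_self _

/-- Applying a circuit and measuring the Pauli observable `P`. -/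
noncomputable def pauliExperiment {d : ℕ} (c : Circuit ι m n d) (P : Paulis (Qubits m n)) :
    Experiment ι m n where
  numMCM := d
  circuit := c
  numOut := 2
  povm := pauliProj P
  povm_psd := pauliProj_posSemidef P
  povm_sum := by
    simp only [Fin.sum_univ_two, pauliProj, Fin.val_zero, Fin.val_one, pow_zero, pow_one]
    module

/-- The weight of an outcome of `pauliExperiment`: a weight of the mid-circuit outcomes times the
measured eigenvalue. -/
noncomputable def pauliWeight {d : ℕ} (c : Circuit ι m n d) (P : Paulis (Qubits m n))
    (w : (Fin d → Bits (Fin n)) → ℝ) :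
    (Fin (pauliExperiment c P).numMCM → Bits (Fin n)) → Fin (pauliExperiment c P).numOut → ℝ :=
  fun k j => w k * (-1) ^ (j : ℕ)

lemma mean_pauliExperiment (S : Setup ι m n) (N : NoiseModel ι m n) {d : ℕ}
    (c : Circuit ι m n d) (P : Paulis (Qubits m n)) (w : (Fin d → Bits (Fin n)) → ℝ) :
    (pauliExperiment c P).mean S N (pauliWeight c P w) =
      N.measNoise.lam (pt P) *
        (∑ k, (w k : ℂ) * (pauliOp P * N.run S c k N.state).trace).re := by
  have h : ∀ k, ∑ j : Fin 2, (w k * (-1) ^ (j : ℕ)) *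
      ((pauliProj P j * N.measNoise.apply (N.run S c k N.state)).trace).re =
      N.measNoise.lam (pt P) * ((w k : ℂ) * (pauliOp P * N.run S c k N.state).trace).re := by
    intro k
    have ht := congrArg Complex.re (N.measNoise.trace_apply P (N.run S c k N.state))
    rw [Complex.re_ofReal_mul] at ht
    rw [Complex.re_ofReal_mul, mul_left_comm, ← ht]
    simp [pauliProj, add_mul, Matrix.trace_add, Matrix.trace_smul]
    ring
  rw [Complex.re_sum, Finset.mul_sum]
  exact Finset.sum_congr rfl fun k _ => h k

/-- A Pauli component of a state is real. -/
lemma ofReal_re_trace_pauliOp_mul_state (N : NoiseModel ι m n) (P : Paulis (Qubits m n)) :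
    (((pauliOp P * N.state).trace.re : ℝ) : ℂ) = (pauliOp P * N.state).trace := by
  rw [← Complex.conj_eq_iff_re, ← Complex.star_def, ← Matrix.trace_conjTranspose,
    Matrix.conjTranspose_mul, pauliOp_conjTranspose, N.state_psd.isHermitian.eq,
    Matrix.trace_mul_comm]

lemma mean_pauliExperiment_done (S : Setup ι m n) (N : NoiseModel ι m n)
    (P : Paulis (Qubits m n)) :
    (pauliExperiment (.done : Circuit ι m n 0) P).mean S N (pauliWeight .done P fun _ => 1) =
      N.measNoise.lam (pt P) * (pauliOp P * N.state).trace.re := by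
  rw [mean_pauliExperiment S N .done P fun _ => 1]
  simp [NoiseModel.run]

lemma Indistinguishable.mean_eq {S : Setup ι m n} {N₁ N₂ : NoiseModel ι m n}
    (h : Indistinguishable S N₁ N₂) (E : Experiment ι m n)
    (w : (Fin E.numMCM → Bits (Fin n)) → Fin E.numOut → ℝ) :
    E.mean S N₁ w = E.mean S N₂ w := by
  simp only [Experiment.mean, h E]

lemma exists_experiment_of_isPath (S : Setup ι m n) {v₀ vₗ : Bits (Qubits m n)}
    {es : List (Edge m n)} (h : IsPath S.mcmGate v₀ es vₗ) (P₀ : Paulis (Qubits m n))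
    (hP₀ : pt P₀ = v₀) :
    ∃ (Es : Experiment ι m n) (ws : (Fin Es.numMCM → Bits (Fin n)) → Fin Es.numOut → ℝ),
      ∀ N : NoiseModel ι m n, (pauliOp P₀ * N.state).trace ≠ 0 →
        let t := (pauliExperiment (.done : Circuit ι m n 0) P₀).mean S N
          (pauliWeight .done P₀ fun _ => 1)
        0 < Es.mean S N ws / t ∧ pathFn v₀ es vₗ N = Real.log (Es.mean S N ws / t) := by
  obtain ⟨d, c, w, P, rfl, hc⟩ := exists_circuit_of_isPath S h P₀ hP₀
  subst hP₀
  refine ⟨pauliExperiment c P, pauliWeight c P w, fun N hN => ?_⟩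
  intro t
  have hre : (pauliOp P₀ * N.state).trace.re ≠ 0 := fun h0 =>
    hN (by rw [← ofReal_re_trace_pauliOp_mul_state, h0, Complex.ofReal_zero])
  have h₀ := N.measNoise.lam_pt_pos P₀
  have hₗ := N.measNoise.lam_pt_pos P
  have he := edgeProd_pos es N
  have hratio : (pauliExperiment c P).mean S N (pauliWeight c P w) / t =
      N.measNoise.lam (pt P) * edgeProd es N / N.measNoise.lam (pt P₀) := by
    simp only [t]
    rw [mean_pauliExperiment_done, mean_pauliExperiment, hc, Complex.re_ofReal_mul]
    field_simp
  rw [hratio]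
  refine ⟨by positivity, ?_⟩
  rw [Real.log_div (by positivity) h₀.ne', Real.log_mul hₗ.ne' he.ne', log_edgeProd]
  simp only [pathFn, vertexFn, Pi.add_apply, Pi.neg_apply]
  ring

end MCM

theorem theorem1 {ι : Type*} {m n : ℕ} (S : MCM.Setup ι m n)
    (v₀ vₗ : MCM.Bits (MCM.Qubits m n)) (es : List (MCM.Edge m n))
    (hpath : MCM.IsPath S.mcmGate v₀ es vₗ) :
    MCM.LearnableOn S {N | N.HasComponent v₀} (MCM.pathFn v₀ es vₗ) ∧
    ∀ P₀ : MCM.Paulis (MCM.Qubits m n), MCM.pt P₀ = v₀ →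
      ∃ (Es : MCM.Experiment ι m n)
        (ws : (Fin Es.numMCM → MCM.Bits (Fin n)) → Fin Es.numOut → ℝ)
        (Et : MCM.Experiment ι m n)
        (wt : (Fin Et.numMCM → MCM.Bits (Fin n)) → Fin Et.numOut → ℝ),
        ∀ N : MCM.NoiseModel ι m n, (MCM.pauliOp P₀ * N.state).trace ≠ 0 →
          0 < Es.mean S N ws / Et.mean S N wt ∧
          MCM.pathFn v₀ es vₗ N = Real.log (Es.mean S N ws / Et.mean S N wt) := by
  refine ⟨?_, fun P₀ hP₀ => ?_⟩
  · rintro N₁ ⟨P₀, hP₀, hN₁⟩ N₂ - hind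
    obtain ⟨Es, ws, hE⟩ := MCM.exists_experiment_of_isPath (ι := ι) S hpath P₀ hP₀
    -- `N₂` may have a component of pattern `v₀` at another Pauli string, but it also has one at
    -- `P₀`: otherwise the experiment that measures `P₀` would tell the two models apart.
    have hN₂ : (MCM.pauliOp P₀ * N₂.state).trace ≠ 0 := by
      intro h0
      have ht := hind.mean_eq (MCM.pauliExperiment (.done : MCM.Circuit ι m n 0) P₀)
        (MCM.pauliWeight .done P₀ fun _ => 1)
      rw [MCM.mean_pauliExperiment_done, MCM.mean_pauliExperiment_done, h0, Complex.zero_re,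
        mul_zero] at ht
      rcases mul_eq_zero.1 ht with h | h
      · exact (N₁.measNoise.lam_pt_pos P₀).ne' h
      · exact hN₁ (by rw [← MCM.ofReal_re_trace_pauliOp_mul_state, h, Complex.ofReal_zero])
    rw [(hE N₁ hN₁).2, (hE N₂ hN₂).2, hind.mean_eq, hind.mean_eq]
  · obtain ⟨Es, ws, hE⟩ := MCM.exists_experiment_of_isPath (ι := ι) S hpath P₀ hP₀
    exact ⟨Es, ws, _, _, hE⟩
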